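/- Let $H$ be a real Hilbert space and consider $\min_{u\in H} f(u):=\mathcal F(u)+\mathcal R(u)$, where * $\mathcal R:H\to\mathbb R\cup\{\pm\infty\}$ is proper, convex and lower semicontinuous, with effective domain $\operatorname{dom}\mathcal R$; * $\mathcal F:H\to\mathbb R$ is convex, and continuously Fréchet differentiable on a set $D\supseteq\operatorname{dom}\mathcal R$ (for instance $D=H$), with $\nabla\mathcal F$ Lipschitz continuous on $D$. Let $S^*:=\{u\in H:\ -\nabla\mathcal F(u)\in\partial\mathcal R(u)\}$ be the set of critical points, which under these assumptions is the set of minimizers of $f$; assume $S^*\neq\emptyset$, and put $f^*:=\inf_H f$. For $\alpha>0$ let $T_\alpha(u)$ be the minimizer of $v\mapsto \mathcal R(v)+\frac{\alpha}{2}\|v-(u-\frac1\alpha\nabla\mathcal F(u))\|^2$ and let $G_\alpha(u):=\alpha(u-T_\alpha(u))$. Fix $0<\delta<1$, $\eta>1$, $m_{\max}\in\mathbb N_0$, $0<\alpha_{\inf}<\alpha_{\sup}$ and $u_0\in D$. Put $m(0)=0$ and $m(k)=\min\{m(k-1)+1,m_{\max}\}$ for $k\ge1$. Let $\{u_k\}$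 be generated by the nonmonotone splitting algorithm: for $k=0,1,2,\dots$, given a real number $\alpha^{BB}_k$ (for instance a Barzilai–Borwein quotient; the choice is arbitrary), set $\alpha_k=\max\{\alpha_{\inf},\min\{\alpha_{\sup},\alpha_k^{BB}\}\}\,\eta^{i_k}$, where $i_k\ge0$ is the smallest integer for which $$f(T_{\alpha_k}(u_k))\le\max_{0\le j\le m(k)}f(u_{k-j})-\frac{\delta}{\alpha_k}\|G_{\alpha_k}(u_k)\|^2 ,$$ and set $u_{k+1}=u_k-\frac1{\alpha_k}G_{\alpha_k}(u_k)=T_{\alpha_k}(u_k)$. (If $G_{\alpha_k}(u_k)=0$ the algorithm stops; the sequence is then continued by the constant $u_k$.) Then: 1. Every sequential weak accumulation point of $\{u_k\}$ belongs to $S^*$. 2. There is a minimizer $u^*\in S^*$ of $f$ such that $u_k\rightharpoonup u^*$ weakly and $P_{S^*}u_k\to u^*$ strongly, where $P_{S^*}$ is the orthogonal projection onto $S^*$. 3. $f(u_k)\to f^*$, and there are constants $\rho_1,\rho_2>0$ such that $f(u_k)-f^*\le\dfrac{\rho_1}{\rho_2+k}$ for all sufficiently large $k$. -/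

import Mathlib

noncomputable section

namespace FBS

open Filter Topology

variable {H : Type*} [NormedAddCommGroup H] [InnerProductSpace ℝ H]

/-- Effective domain of an extended real-valued function. -/
def dom (φ : H → EReal) : Set H := {u | φ u < ⊤}

/-- `φ` never takes the value `-∞` and is not identically `+∞`. -/
def IsProper (φ : H → EReal) : Prop := (∀ u, φ u ≠ ⊥) ∧ (dom φ).Nonempty

/-- Convexity of an extended real-valued function: the epigraph is convex. -/
def IsConvex (φ : H → EReal) : Prop := Convex ℝ {p : H × ℝ | φ p.1 ≤ (p.2 : EReal)}

/-- Convex subdifferential of `φ` at `u` (empty outside the effective domain). -/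
def subdiff (φ : H → EReal) (u : H) : Set H :=
  {w | u ∈ dom φ ∧ ∀ v, φ u + ((inner ℝ w (v - u) : ℝ) : EReal) ≤ φ v}

/-- The composite cost `f = F + R`. -/
def cost (F : H → ℝ) (R : H → EReal) (u : H) : EReal := (F u : EReal) + R u

/-- The infimum of the composite cost over the whole space. -/
def optVal (F : H → ℝ) (R : H → EReal) : EReal := ⨅ u, cost F R u

/-- The proximal operator `prox_{R/α}`: `prox R α u` minimizes `v ↦ R v + (α/2) ‖v - u‖²`.
For `α > 0` and `R` proper, convex and lower semicontinuous there is exactly one minimizer. -/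
def prox (R : H → EReal) (α : ℝ) (u : H) : H :=
  Classical.epsilon fun v => ∀ w,
    R v + ((α / 2 * ‖v - u‖ ^ 2 : ℝ) : EReal) ≤ R w + ((α / 2 * ‖w - u‖ ^ 2 : ℝ) : EReal)

/-- Orthogonal projection onto `S`: a nearest point of `S`. For `S` nonempty, closed and convex in
a Hilbert space there is exactly one nearest point. -/
def proj (S : Set H) (u : H) : H :=
  Classical.epsilon fun p => p ∈ S ∧ ∀ q ∈ S, ‖u - p‖ ≤ ‖u - q‖

/-- Weak convergence of a sequence. -/
def WeakTendsto (u : ℕ → H) (x : H) : Prop :=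
  Tendsto (fun k => toWeakSpace ℝ H (u k)) atTop (𝓝 (toWeakSpace ℝ H x))

/-- `x` is the weak limit of a subsequence of `u`. -/
def IsWeakSeqAccPt (u : ℕ → H) (x : H) : Prop :=
  ∃ φ : ℕ → ℕ, StrictMono φ ∧ WeakTendsto (u ∘ φ) x

/-- Memory of the linesearch: `m 0 = 0`, `m (k + 1) = min (m k + 1) mmax`. -/
def memory (mmax : ℕ) : ℕ → ℕ
  | 0 => 0
  | k + 1 => min (memory mmax k + 1) mmax

/-- `max_{0 ≤ j ≤ m k} f (u (k - j))`. -/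
def windowMax (F : H → ℝ) (R : H → EReal) (mmax : ℕ) (u : ℕ → H) (k : ℕ) : EReal :=
  (Finset.range (memory mmax k + 1)).sup fun j => cost F R (u (k - j))

variable [CompleteSpace H]

/-- The critical points of `F + R`: those `u` with `-∇F u ∈ ∂R u`. -/
def crit (F : H → ℝ) (R : H → EReal) : Set H := {u | -gradient F u ∈ subdiff R u}

/-- The prox-grad operator `T_α u = prox_{R/α} (u - (1/α) ∇F u)`. -/
def proxGrad (F : H → ℝ) (R : H → EReal) (α : ℝ) (u : H) : H :=
  prox R α (u - (1 / α) • gradient F u)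

/-- The gradient mapping `G_α u = α (u - T_α u)`. -/
def gradMap (F : H → ℝ) (R : H → EReal) (α : ℝ) (u : H) : H :=
  α • (u - proxGrad F R α u)

/-- The nonmonotone linesearch inequality at iteration `k` for the step-size parameter `α`;
the candidate for the next iterate is `T_α (u k) = u k - (1/α) G_α (u k)`. -/
def LineSearch (F : H → ℝ) (R : H → EReal) (δ : ℝ) (mmax : ℕ) (u : ℕ → H) (k : ℕ) (α : ℝ) : Prop :=
  cost F R (proxGrad F R α (u k)) ≤
    windowMax F R mmax u k - ((δ / α * ‖gradMap F R α (u k)‖ ^ 2 : ℝ) : EReal)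

/-- `u` is generated by the nonmonotone splitting algorithm with parameters `δ`, `η`, `mmax`,
`αinf`, `αsup`. In iteration `k` a real number `β k` is clipped to `[αinf, αsup]` to give the first
trial value; it is multiplied by the least power of `η` for which the linesearch inequality holds,
which gives `α k`; then `u (k + 1) = u k - (1 / α k) G_{α k} (u k)`.
The numbers `β k` are unrestricted, so they may be produced by any Barzilai-Borwein rule, with any
convention for the first iteration and for vanishing denominators.
If the stopping test `G (u k) = 0` is met then the update gives `u (k + 1) = u k`, so a run that
stops is represented by its constant continuation. -/
def IsGenerated (F : H → ℝ) (R : H → EReal) (δ η : ℝ) (mmax : ℕ) (αinf αsup : ℝ)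
    (u : ℕ → H) : Prop :=
  ∃ (β α : ℕ → ℝ) (i : ℕ → ℕ), ∀ k,
    IsLeast {n : ℕ | LineSearch F R δ mmax u k (max αinf (min αsup (β k)) * η ^ n)} (i k) ∧
    α k = max αinf (min αsup (β k)) * η ^ (i k) ∧
    u (k + 1) = u k - (1 / α k) • gradMap F R (α k) (u k)

/-- Standing assumptions of the convex case. `R` is proper, convex and lower semicontinuous;
`F` is continuously differentiable on a set `D` containing the effective domain of `R`, with
`L`-Lipschitz gradient there; and `F` is convex. -/
structure ConvexSetting (F : H → ℝ) (R : H → EReal) (D : Set H) (L : NNReal) : Prop where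
  proper : IsProper R
  convex_R : IsConvex R
  lsc : LowerSemicontinuous R
  dom_subset : dom R ⊆ D
  differentiableAt : ∀ u ∈ D, DifferentiableAt ℝ F u
  continuousOn_gradient : ContinuousOn (gradient F) D
  lipschitz : LipschitzOnWith L (gradient F) D
  convex_F : ConvexOn ℝ Set.univ F

end FBS

end

/-!
For a nonmonotone linesearch the one-step decrease is measured against the largest cost in a window
of recent iterates, so summing it does not directly bound `∑ ‖u (k + 1) - u k‖²`. Convexity
supplies this bound. Write `a k` for the excess cost, `e k = ‖u (k + 1) - u k‖²`, and `M k` for the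
maximum of `a` over the window ending at `k`. The prox-grad inequality gives
`a (k + 1) ≤ a k + L e k`, the linesearch gives `a (k + 1) ≤ M k - c e k`, and eliminating `e k`
leaves `a (k + 1) ≤ (1 - q) M k + q a k` with some `0 < q ≤ 1`. A value far below `M k` therefore
keeps the following values, up to a power of `q`, below `M k` as well, so that `M k - a (k + 1)` is
at most a constant times the decrease of `M` over one window length. These decreases telescope;
since `c e k ≤ M k - a (k + 1)`, it follows that `∑ e k < ∞` (`summable_of_nonmonotone_decrease`).

For a critical point `s` the prox-grad inequality reads
`‖u (k + 1) - s‖² + (2 / α k) a (k + 1) ≤ ‖u k - s‖² + C e k`. The step sizes are bounded, because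
convexity of `F` makes the linesearch succeed as soon as `L ≤ (1 - δ) α`. Hence `u` is quasi-Fejér
monotone with respect to the critical points and `∑ a k < ∞`
(`ConvexSetting.exists_excess_quasiFejer`).

* As `M` is nonincreasing and summable, `k M k` is bounded, which is the rate
  (`exists_le_div_of_summable`).
* Sublevel sets of the cost are closed and convex, hence weakly closed, so weak cluster points are
  minimizers, that is, critical points. Opial's argument in the weakly compact balls then gives
  weak convergence (`exists_weakTendsto_of_quasiFejer`), and the projections onto the set of
  critical points form a Cauchy sequence with the same limit (`tendsto_proj_of_quasiFejer`).

The initial point may lie outside the domain of `R`, where the cost is infinite; all estimates are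
therefore made for the sequence `u (n + 1)`.
-/

namespace FBS

open Filter Topology Set

section General

variable {H : Type*} [NormedAddCommGroup H] [InnerProductSpace ℝ H]

/-! ### Convex differentiable functions -/

section Gradient

variable [CompleteSpace H] {G : H → ℝ} {g x y : H} {c : ℝ}

/-- An upper bound on the difference quotients along `y` bounds the derivative along `y`. -/
lemma inner_le_of_forall_le_add (hg : HasGradientAt G g x)
    (h : ∀ t : ℝ, 0 < t → t < 1 → G (x + t • y) ≤ G x + t * c) : inner ℝ g y ≤ c := by
  have hl : HasDerivAt (fun t : ℝ => x + t • y) y 0 := by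
    simpa using ((hasDerivAt_id (0 : ℝ)).smul_const y).const_add x
  have hd : HasDerivAt (fun t : ℝ => G (x + t • y)) (inner ℝ g y) 0 := by
    have hf : HasFDerivAt G (InnerProductSpace.toDual ℝ H g) (x + (0 : ℝ) • y) := by
      simpa using hg.hasFDerivAt
    have := hf.comp_hasDerivAt (0 : ℝ) hl
    rw [InnerProductSpace.toDual_apply_apply] at this
    exact this
  refine le_of_tendsto hd.tendsto_slope_zero_right ?_
  filter_upwards [Ioo_mem_nhdsGT (zero_lt_one (α := ℝ))] with t ht
  have := h t ht.1 ht.2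
  simp only [zero_add, zero_smul, add_zero, smul_eq_mul]
  rw [inv_mul_le_iff₀ ht.1]
  linarith

lemma le_inner_of_forall_sub_le (hg : HasGradientAt G g x)
    (h : ∀ t : ℝ, 0 < t → t < 1 → G x - t * c ≤ G (x + t • y)) : -c ≤ inner ℝ g y := by
  have hg' : HasGradientAt (fun z => - G z) (-g) x := by
    have := hg.hasFDerivAt.neg
    rw [hasGradientAt_iff_hasFDerivAt, map_neg]
    exact this
  have := inner_le_of_forall_le_add (y := y) (c := c) hg' fun t h0 h1 => by
    have := h t h0 h1
    linarith
  rw [inner_neg_left] at this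
  linarith

lemma add_inner_le_of_convexOn (hG : ConvexOn ℝ univ G) (hg : HasGradientAt G g x) (v : H) :
    G x + inner ℝ g (v - x) ≤ G v := by
  have := inner_le_of_forall_le_add (y := v - x) (c := G v - G x) hg fun t h0 h1 => by
    have h2 := hG.2 (mem_univ x) (mem_univ v) (sub_nonneg.2 h1.le) h0.le (by ring)
    have h3 : (1 - t) • x + t • v = x + t • (v - x) := by module
    rw [h3, smul_eq_mul, smul_eq_mul] at h2
    linarith
  linarith

end Gradient

lemma continuous_of_convexOn_of_continuousAt {G : H → ℝ} (hG : ConvexOn ℝ univ G) {x : H}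
    (hx : ContinuousAt G x) : Continuous G := by
  rw [← continuousOn_univ]
  have h : ∃ y ∈ univ, ContinuousAt G y := ⟨x, mem_univ x, hx⟩
  exact ((hG.continuousOn_tfae isOpen_univ univ_nonempty).out 2 1 :).1 h

/-! ### The weak topology of a Hilbert space -/

section Weak

/-- Mazur's theorem: closed convex sets are weakly closed. -/
lemma isClosed_image_toWeakSpace {C : Set H} (hC : Convex ℝ C) (hcl : IsClosed C) :
    IsClosed (toWeakSpace ℝ H '' C) := by
  have := hC.toWeakSpace_closure ℝ
  rw [hcl.closure_eq] at this
  exact isClosed_of_closure_subset this.symm.subset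

lemma continuous_inner_toWeakSpace_symm (y : H) :
    Continuous fun z : WeakSpace ℝ H => inner ℝ y ((toWeakSpace ℝ H).symm z) :=
  WeakBilin.eval_continuous (topDualPairing ℝ H).flip (innerSL ℝ y)

lemma WeakTendsto.tendsto_inner {v : ℕ → H} {x : H} (h : WeakTendsto v x) (y : H) :
    Tendsto (fun n => inner ℝ y (v n)) atTop (𝓝 (inner ℝ y x)) :=
  ((continuous_inner_toWeakSpace_symm y).tendsto _).comp h

lemma weakTendsto_unique {v : ℕ → H} {x y : H} (hx : WeakTendsto v x) (hy : WeakTendsto v y) :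
    x = y :=
  ext_inner_left ℝ fun z => tendsto_nhds_unique (hx.tendsto_inner z) (hy.tendsto_inner z)

/-- The Banach–Alaoglu theorem carried over to the Hilbert space by the Riesz isomorphism. -/
lemma isCompact_image_toWeakSpace_closedBall [CompleteSpace H] (r : ℝ) :
    IsCompact (toWeakSpace ℝ H '' Metric.closedBall 0 r) := by
  set e := (InnerProductSpace.toDual ℝ H).symm
  let T : WeakDual ℝ H → WeakSpace ℝ H := fun ψ => toWeakSpace ℝ H (e (WeakDual.toStrongDual ψ))
  have hT : Continuous T := by
    refine WeakBilin.continuous_of_continuous_eval _ fun ℓ => ?_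
    have : (fun ψ : WeakDual ℝ H => (topDualPairing ℝ H).flip (T ψ) ℓ) = fun ψ => ψ (e ℓ) := by
      funext ψ
      change ℓ (e (WeakDual.toStrongDual ψ)) = (WeakDual.toStrongDual ψ) (e ℓ)
      rw [← InnerProductSpace.toDual_symm_apply (y := ℓ),
        ← InnerProductSpace.toDual_symm_apply (y := WeakDual.toStrongDual ψ), real_inner_comm]
    rw [this]
    exact WeakDual.eval_continuous _
  have := (WeakDual.isCompact_closedBall (𝕜 := ℝ) (E := H) 0 r).image hT
  convert this using 1
  ext z
  constructor
  · rintro ⟨x, hx, rfl⟩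
    refine ⟨StrongDual.toWeakDual (InnerProductSpace.toDual ℝ H x), ?_, ?_⟩
    · simpa using hx
    · simp [T, e]
  · rintro ⟨ψ, hψ, rfl⟩
    refine ⟨e (WeakDual.toStrongDual ψ), ?_, rfl⟩
    simpa using hψ

lemma isCompact_image_toWeakSpace [CompleteSpace H] {C : Set H} (hC : Convex ℝ C)
    (hcl : IsClosed C) (hb : Bornology.IsBounded C) : IsCompact (toWeakSpace ℝ H '' C) := by
  obtain ⟨r, hr⟩ := hb.subset_closedBall 0
  exact (isCompact_image_toWeakSpace_closedBall r).of_isClosed_subset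
    (isClosed_image_toWeakSpace hC hcl) (image_mono hr)

lemma mem_of_mapClusterPt_toWeakSpace {C : Set H} (hC : Convex ℝ C) (hcl : IsClosed C)
    {v : ℕ → H} (hv : ∀ᶠ n in atTop, v n ∈ C) {x : H}
    (hx : MapClusterPt (toWeakSpace ℝ H x) atTop fun n => toWeakSpace ℝ H (v n)) : x ∈ C := by
  have h1 := (isClosed_image_toWeakSpace hC hcl).mem_of_mapClusterPt hx
    (hv.mono fun n hn => mem_image_of_mem _ hn)
  obtain ⟨y, hy, hxy⟩ := h1
  exact (toWeakSpace ℝ H).injective hxy ▸ hy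

end Weak

end General

/-! ### Real sequences with a nonmonotone decrease -/

section Sequences

/-- The maximum of `a` over the `m + 1` consecutive indices `n, …, n + m`. -/
noncomputable def slidingMax (a : ℕ → ℝ) (m n : ℕ) : ℝ :=
  (Finset.range (m + 1)).sup' Finset.nonempty_range_add_one fun j => a (n + j)

variable {a e : ℕ → ℝ} {m : ℕ}

lemma le_slidingMax {n j : ℕ} (hj : j ≤ m) : a (n + j) ≤ slidingMax a m n :=
  Finset.le_sup' (fun j => a (n + j)) (Finset.mem_range.2 (Nat.lt_succ_of_le hj))

lemma slidingMax_le_iff {n : ℕ} {b : ℝ} : slidingMax a m n ≤ b ↔ ∀ j ≤ m, a (n + j) ≤ b := by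
  simp [slidingMax, Finset.sup'_le_iff]

lemma antitone_slidingMax (h : ∀ n, a (n + m + 1) ≤ slidingMax a m n) :
    Antitone (slidingMax a m) := by
  refine antitone_nat_of_succ_le fun n => slidingMax_le_iff.2 fun j hj => ?_
  rcases hj.lt_or_eq with hj | rfl
  · have := le_slidingMax (a := a) (n := n) (Nat.succ_le_of_lt hj)
    rwa [show n + 1 + j = n + (j + 1) by ring]
  · rw [show n + 1 + j = n + j + 1 by ring]
    exact h n

lemma summable_sub_add_of_antitone {M : ℕ → ℝ} (hM : Antitone M) (h0 : ∀ n, 0 ≤ M n) (p : ℕ) :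
    Summable fun n => M n - M (n + p) := by
  have h1 : Summable fun n => M n - M (n + 1) := by
    refine summable_of_sum_range_le (c := M 0) (fun n => sub_nonneg.2 (hM n.le_succ)) fun n => ?_
    rw [Finset.sum_range_sub']
    linarith [h0 n]
  induction p with
  | zero => simp [summable_zero]
  | succ p ih =>
    have h2 := (summable_nat_add_iff p).2 h1
    refine (ih.add h2).congr fun n => ?_
    rw [show n + (p + 1) = n + p + 1 by ring]
    ring

/-- The key summability. If a step of size `e n` raises `a` by at most `L * e n` and pushes the
next value below the current sliding maximum by at least `c * e n`, then each value lies below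
a fixed convex combination of the sliding maximum and the preceding value. Hence a drop of
`a` below its sliding maximum is felt, up to a factor `q ^ m`, during the whole next window,
so that the drop is controlled by the telescoping decrease of the sliding maximum. -/
lemma summable_of_nonmonotone_decrease {c L : ℝ} (hc : 0 < c) (hL : 0 < L) (ha : ∀ n, 0 ≤ a n)
    (he : ∀ n, 0 ≤ e n) (hstep : ∀ n, a (n + 1) ≤ a n + L * e n)
    (hwin : ∀ n, a (n + m + 1) ≤ slidingMax a m n - c * e (n + m)) : Summable e := by
  set M := slidingMax a m with hMdef
  have hwin' : ∀ n, a (n + m + 1) ≤ M n := fun n => by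
    have := hwin n
    have := mul_nonneg hc.le (he (n + m))
    linarith
  have hM : Antitone M := antitone_slidingMax hwin'
  have hM0 : ∀ n, 0 ≤ M n := fun n => (ha (n + 0)).trans (le_slidingMax m.zero_le)
  -- adding `c` times the bound by `L` to `L` times the bound by `c` eliminates `e`
  set q := c / (L + c) with hq
  have hq0 : 0 < q := by positivity
  have hq1 : q ≤ 1 := (div_le_one (by positivity)).2 (by linarith)
  have hcomb : ∀ n, a (n + m + 1) ≤ (1 - q) * M n + q * a (n + m) := fun n => by
    have h1 := hstep (n + m)
    have h2 := hwin n
    have h3 : (1 - q) * M n + q * a (n + m) = (L * M n + c * a (n + m)) / (L + c) := by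
      rw [hq]; field_simp; ring
    rw [h3, le_div_iff₀ (by positivity)]
    nlinarith
  have hdrop : ∀ n j, a (n + m + 1 + j) ≤ M n - q ^ j * (M n - a (n + m + 1)) := fun n j => by
    induction j with
    | zero => simp
    | succ j ih =>
      have h1 := hcomb (n + 1 + j)
      rw [show n + 1 + j + m + 1 = n + m + 1 + (j + 1) by ring,
        show n + 1 + j + m = n + m + 1 + j by ring] at h1
      have h2 : M (n + 1 + j) ≤ M n := hM (by omega)
      have h3 := mul_le_mul_of_nonneg_left h2 (sub_nonneg.2 hq1)
      have h4 := mul_le_mul_of_nonneg_left ih hq0.le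
      rw [pow_succ]
      linarith
  have hqm : 0 < q ^ m * c := by positivity
  have hbound : ∀ n, q ^ m * c * e (n + m) ≤ M n - M (n + (m + 1)) := fun n => by
    have h1 : c * e (n + m) ≤ M n - a (n + m + 1) := by linarith [hwin n]
    have h2 : M (n + (m + 1)) ≤ M n - q ^ m * (M n - a (n + m + 1)) := by
      refine slidingMax_le_iff.2 fun j hj => (hdrop n j).trans ?_
      have h3 := pow_le_pow_of_le_one hq0.le hq1 hj
      have h4 : 0 ≤ M n - a (n + m + 1) := by linarith [hwin' n]
      linarith [mul_le_mul_of_nonneg_right h3 h4]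
    have h5 := mul_le_mul_of_nonneg_left h1 (pow_pos hq0 m).le
    linarith
  have hs : Summable fun n => q ^ m * c * e (n + m) :=
    Summable.of_nonneg_of_le (fun n => mul_nonneg hqm.le (he _)) hbound
      (summable_sub_add_of_antitone hM hM0 (m + 1))
  exact (summable_nat_add_iff m).1 ((summable_mul_left_iff hqm.ne').1 hs)

/-- A summable sequence whose sliding maximum is nonincreasing is `O(1 / n)`: the sliding maximum is
summable as well, and a nonincreasing summable sequence is `O(1 / n)`. -/
lemma exists_le_div_of_summable (hwin : ∀ n, a (n + m + 1) ≤ slidingMax a m n)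
    (ha : ∀ n, 0 ≤ a n) (hs : Summable a) : ∃ B > (0 : ℝ), ∀ n, a n ≤ B / (n + 1) := by
  have hM : Antitone (slidingMax a m) := antitone_slidingMax hwin
  have hM0 : ∀ n, 0 ≤ slidingMax a m n :=
    fun n => (ha (n + 0)).trans (le_slidingMax m.zero_le)
  have hMs : Summable (slidingMax a m) := by
    refine Summable.of_nonneg_of_le hM0 (fun n => ?_)
      (summable_sum (s := Finset.range (m + 1)) (f := fun j n => a (n + j)) fun j _ =>
        (summable_nat_add_iff j).2 hs)
    exact slidingMax_le_iff.2 fun j hj =>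
      Finset.single_le_sum (f := fun j => a (n + j)) (fun j _ => ha _)
        (Finset.mem_range.2 (Nat.lt_succ_of_le hj))
  have hB : 0 ≤ ∑' n, slidingMax a m n := tsum_nonneg hM0
  refine ⟨∑' n, slidingMax a m n + 1, by linarith, fun n => ?_⟩
  rw [le_div_iff₀ (by positivity)]
  have h1 : ((n : ℝ) + 1) * slidingMax a m n ≤ ∑ k ∈ Finset.range (n + 1), slidingMax a m k := by
    have := Finset.card_nsmul_le_sum (Finset.range (n + 1)) (slidingMax a m) (slidingMax a m n)
      fun k hk => hM (Nat.lt_succ_iff.1 (Finset.mem_range.1 hk))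
    simpa using this
  have h2 := hMs.sum_le_tsum (Finset.range (n + 1)) fun k _ => hM0 k
  have h3 : a n ≤ slidingMax a m n := le_slidingMax (n := n) m.zero_le
  have h4 := mul_le_mul_of_nonneg_right h3 (by positivity : (0 : ℝ) ≤ n + 1)
  linarith

lemma antitone_sub_sum_range {d ε : ℕ → ℝ} (h : ∀ n, d (n + 1) ≤ d n + ε n) :
    Antitone fun n => d n - ∑ k ∈ Finset.range n, ε k :=
  antitone_nat_of_succ_le fun n => by
    rw [Finset.sum_range_succ]
    linarith [h n]

lemma exists_tendsto_sub_sum_range {d ε : ℕ → ℝ} (hd : ∀ n, 0 ≤ d n) (hε : ∀ n, 0 ≤ ε n)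
    (hs : Summable ε) (h : ∀ n, d (n + 1) ≤ d n + ε n) :
    ∃ l, Tendsto (fun n => d n - ∑ k ∈ Finset.range n, ε k) atTop (𝓝 l) := by
  refine ⟨_, tendsto_atTop_ciInf (antitone_sub_sum_range h) ⟨-∑' k, ε k, ?_⟩⟩
  rintro _ ⟨n, rfl⟩
  have := hs.sum_le_tsum (Finset.range n) fun k _ => hε k
  have := hd n
  simp only
  linarith

lemma exists_tendsto_of_le_add_summable {d ε : ℕ → ℝ} (hd : ∀ n, 0 ≤ d n) (hε : ∀ n, 0 ≤ ε n)
    (hs : Summable ε) (h : ∀ n, d (n + 1) ≤ d n + ε n) : ∃ l, Tendsto d atTop (𝓝 l) := by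
  obtain ⟨l, hl⟩ := exists_tendsto_sub_sum_range hd hε hs h
  exact ⟨_, (hl.add hs.hasSum.tendsto_sum_nat).congr fun n => sub_add_cancel _ _⟩

lemma summable_of_add_le_add {d b ε : ℕ → ℝ} (hd : ∀ n, 0 ≤ d n) (hb : ∀ n, 0 ≤ b n)
    (hε : ∀ n, 0 ≤ ε n) (hs : Summable ε) (h : ∀ n, d (n + 1) + b n ≤ d n + ε n) :
    Summable b := by
  refine summable_of_sum_range_le (c := d 0 + ∑' k, ε k) hb fun n => ?_
  have h1 := hs.sum_le_tsum (Finset.range n) fun k _ => hε k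
  have h2 : d n + ∑ k ∈ Finset.range n, b k ≤ d 0 + ∑ k ∈ Finset.range n, ε k := by
    induction n with
    | zero => simp
    | succ n ih =>
      have := ih (hs.sum_le_tsum (Finset.range n) fun k _ => hε k)
      rw [Finset.sum_range_succ, Finset.sum_range_succ]
      linarith [h n]
  linarith [hd n]

end Sequences

/-! ### Quasi-Fejér sequences -/

section Fejer

variable {H : Type*} [NormedAddCommGroup H] {S : Set H} {v : ℕ → H} {ε : ℕ → ℝ}

lemma exists_norm_le_of_quasiFejer (hε : ∀ n, 0 ≤ ε n) (hs : Summable ε) {s : H}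
    (hF : ∀ n, ‖v (n + 1) - s‖ ^ 2 ≤ ‖v n - s‖ ^ 2 + ε n) : ∃ B, ∀ n, ‖v n‖ ≤ B := by
  obtain ⟨l, hl⟩ := exists_tendsto_of_le_add_summable (d := fun n => ‖v n - s‖ ^ 2)
    (fun n => sq_nonneg _) hε hs hF
  obtain ⟨B, hB⟩ := hl.bddAbove_range
  refine ⟨B + 1 + ‖s‖, fun n => ?_⟩
  have h1 : ‖v n - s‖ ^ 2 ≤ B := hB ⟨n, rfl⟩
  have h2 : ‖v n‖ ≤ ‖v n - s‖ + ‖s‖ := by simpa using norm_add_le (v n - s) s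
  have h3 : ‖v n - s‖ ≤ B + 1 := by nlinarith [sq_nonneg (‖v n - s‖ - 1)]
  linarith

variable [InnerProductSpace ℝ H] [CompleteSpace H]

lemma proj_spec (hS : S.Nonempty) (hc : Convex ℝ S) (hcl : IsClosed S) (u : H) :
    proj S u ∈ S ∧ ∀ q ∈ S, ‖u - proj S u‖ ≤ ‖u - q‖ := by
  refine Classical.epsilon_spec (p := fun p => p ∈ S ∧ ∀ q ∈ S, ‖u - p‖ ≤ ‖u - q‖) ?_
  obtain ⟨p, hp, h⟩ := exists_norm_eq_iInf_of_complete_convex hS hcl.isComplete hc u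
  refine ⟨p, hp, fun q hq => ?_⟩
  rw [h]
  exact ciInf_le (f := fun w : S => ‖u - w‖)
    ⟨0, forall_mem_range.2 fun _ => norm_nonneg _⟩ ⟨q, hq⟩

lemma inner_sub_proj_le_zero (hS : S.Nonempty) (hc : Convex ℝ S) (hcl : IsClosed S) (u : H)
    {q : H} (hq : q ∈ S) : inner ℝ (u - proj S u) (q - proj S u) ≤ 0 := by
  obtain ⟨hp, h⟩ := proj_spec hS hc hcl u
  refine (norm_eq_iInf_iff_real_inner_le_zero hc hp).1 (le_antisymm ?_ ?_) q hq
  · have := hS.to_subtype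
    exact le_ciInf fun w => h w w.2
  · exact ciInf_le (f := fun w : S => ‖u - w‖)
      ⟨0, forall_mem_range.2 fun _ => norm_nonneg _⟩ ⟨_, hp⟩

/-- The Pythagorean inequality for the projection onto a convex set. -/
lemma norm_sub_proj_sq_add_le (hS : S.Nonempty) (hc : Convex ℝ S) (hcl : IsClosed S) (u : H)
    {q : H} (hq : q ∈ S) : ‖u - proj S u‖ ^ 2 + ‖q - proj S u‖ ^ 2 ≤ ‖u - q‖ ^ 2 := by
  have h1 := inner_sub_proj_le_zero hS hc hcl u hq
  have h2 : u - q = (u - proj S u) - (q - proj S u) := by abel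
  rw [h2, norm_sub_sq_real (u - proj S u)]
  linarith

/-- Opial's lemma: the distances to the points of `S` converge, hence so do the inner products
with a difference of two weak cluster points, and the two coincide. -/
lemma exists_weakTendsto_of_quasiFejer (hS : S.Nonempty) (hε : ∀ n, 0 ≤ ε n) (hs : Summable ε)
    (hF : ∀ s ∈ S, ∀ n, ‖v (n + 1) - s‖ ^ 2 ≤ ‖v n - s‖ ^ 2 + ε n)
    (hcl : ∀ x, MapClusterPt (toWeakSpace ℝ H x) atTop (fun n => toWeakSpace ℝ H (v n)) → x ∈ S) :
    ∃ x ∈ S, WeakTendsto v x := by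
  have hlim : ∀ s ∈ S, ∃ l, Tendsto (fun n => ‖v n - s‖ ^ 2) atTop (𝓝 l) := fun s hsS =>
    exists_tendsto_of_le_add_summable (fun n => sq_nonneg _) hε hs (hF s hsS)
  have huniq : ∀ x y, MapClusterPt (toWeakSpace ℝ H x) atTop (fun n => toWeakSpace ℝ H (v n)) →
      MapClusterPt (toWeakSpace ℝ H y) atTop (fun n => toWeakSpace ℝ H (v n)) → x = y := by
    intro x y hx hy
    obtain ⟨lx, hlx⟩ := hlim x (hcl x hx)
    obtain ⟨ly, hly⟩ := hlim y (hcl y hy)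
    have hin : Tendsto (fun n => inner ℝ (x - y) (v n)) atTop
        (𝓝 ((ly - lx + ‖x‖ ^ 2 - ‖y‖ ^ 2) / 2)) := by
      refine ((((hly.sub hlx).add_const (‖x‖ ^ 2)).sub_const (‖y‖ ^ 2)).div_const 2).congr
        fun n => ?_
      rw [norm_sub_sq_real, norm_sub_sq_real, inner_sub_left, real_inner_comm x, real_inner_comm y]
      ring
    -- the limit of the inner products is their value at every weak cluster point
    have hval : ∀ z, MapClusterPt (toWeakSpace ℝ H z) atTop (fun n => toWeakSpace ℝ H (v n)) →
        inner ℝ (x - y) z = (ly - lx + ‖x‖ ^ 2 - ‖y‖ ^ 2) / 2 := by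
      intro z hz
      have h1 := hz.continuousAt_comp
        (f := fun w : WeakSpace ℝ H => inner ℝ (x - y) ((toWeakSpace ℝ H).symm w))
        (continuous_inner_toWeakSpace_symm (x - y)).continuousAt
      have h2 : ClusterPt (inner ℝ (x - y) z) (map (fun n => inner ℝ (x - y) (v n)) atTop) := by
        simpa [MapClusterPt, Function.comp_def] using h1
      have h3 := h2.mono hin
      rw [ClusterPt] at h3
      exact eq_of_nhds_neBot h3
    have h0 : inner ℝ (x - y) (x - y) = 0 := by
      rw [inner_sub_right, hval x hx, hval y hy, sub_self]
    exact sub_eq_zero.1 (inner_self_eq_zero.1 h0)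
  obtain ⟨s, hsS⟩ := hS
  obtain ⟨B, hB⟩ := exists_norm_le_of_quasiFejer hε hs (hF s hsS)
  have hball : ∀ n, v n ∈ Metric.closedBall (0 : H) B := fun n =>
    mem_closedBall_zero_iff.2 (hB n)
  have hK := isCompact_image_toWeakSpace_closedBall (H := H) B
  have hmem : ∀ᶠ n in atTop, toWeakSpace ℝ H (v n) ∈
      toWeakSpace ℝ H '' Metric.closedBall (0 : H) B :=
    Eventually.of_forall fun n => mem_image_of_mem _ (hball n)
  obtain ⟨_, ⟨x, -, rfl⟩, hx⟩ := hK.exists_mapClusterPt_of_frequently hmem.frequently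
  refine ⟨x, hcl x hx, hK.tendsto_nhds_of_unique_mapClusterPt hmem ?_⟩
  rintro _ ⟨y, -, rfl⟩ hy
  rw [huniq y x hy hx]

/-- The projections `p n` of `v n` satisfy `‖p n - p (n + k)‖² ≤ g n - g (n + k)` for a convergent
sequence `g`, so they converge; the variational inequality of the projection, which combines
weak with strong convergence, identifies their limit with that of `v`. -/
lemma tendsto_proj_of_quasiFejer (hS : S.Nonempty) (hc : Convex ℝ S) (hclosed : IsClosed S)
    (hε : ∀ n, 0 ≤ ε n) (hs : Summable ε)
    (hF : ∀ s ∈ S, ∀ n, ‖v (n + 1) - s‖ ^ 2 ≤ ‖v n - s‖ ^ 2 + ε n)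
    {x : H} (hx : x ∈ S) (hvx : WeakTendsto v x) :
    Tendsto (fun n => proj S (v n)) atTop (𝓝 x) := by
  set p : ℕ → H := fun n => proj S (v n) with hp
  have hpS : ∀ n, p n ∈ S := fun n => (proj_spec hS hc hclosed (v n)).1
  have hpmin : ∀ n, ∀ q ∈ S, ‖v n - p n‖ ^ 2 + ‖q - p n‖ ^ 2 ≤ ‖v n - q‖ ^ 2 :=
    fun n q hq => norm_sub_proj_sq_add_le hS hc hclosed (v n) hq
  set g : ℕ → ℝ := fun n => ‖v n - p n‖ ^ 2 - ∑ k ∈ Finset.range n, ε k with hg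
  have hd : ∀ n, ‖v (n + 1) - p (n + 1)‖ ^ 2 ≤ ‖v n - p n‖ ^ 2 + ε n := fun n => by
    have h1 := hpmin (n + 1) (p n) (hpS n)
    have h2 := hF (p n) (hpS n) n
    linarith [sq_nonneg ‖p n - p (n + 1)‖]
  obtain ⟨l, hl⟩ : ∃ l, Tendsto g atTop (𝓝 l) :=
    exists_tendsto_sub_sum_range (fun n => sq_nonneg _) hε hs hd
  have hpg : ∀ n k, n ≤ k → ‖p n - p k‖ ^ 2 ≤ g n - g k := fun n k hnk => by
    have h1 := antitone_sub_sum_range (d := fun j => ‖v j - p n‖ ^ 2) (hF (p n) (hpS n)) hnk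
    have h2 := hpmin k (p n) (hpS n)
    simp only [hg] at h1 ⊢
    linarith
  have hgl : ∀ n, l ≤ g n := fun n => (antitone_sub_sum_range hd).le_of_tendsto hl n
  have hcauchy : CauchySeq p := by
    refine Metric.cauchySeq_iff'.2 fun r hr => ?_
    obtain ⟨N, hN⟩ := (hl.eventually_lt_const (show l < l + r ^ 2 by
      have := pow_pos hr 2; linarith)).exists
    refine ⟨N, fun n hn => ?_⟩
    have h1 := hpg N n hn
    have h2 := hgl n
    rw [dist_comm, dist_eq_norm]
    exact lt_of_pow_lt_pow_left₀ 2 hr.le (by linarith)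
  obtain ⟨y, hy⟩ := cauchySeq_tendsto_of_complete hcauchy
  obtain ⟨B, hB⟩ := exists_norm_le_of_quasiFejer hε hs (hF x hx)
  have hyp : Tendsto (fun n => y - p n) atTop (𝓝 0) := by simpa using hy.const_sub y
  have h1 : Tendsto (fun n => inner ℝ (y - p n) (v n)) atTop (𝓝 0) := by
    refine squeeze_zero_norm (a := fun n => ‖y - p n‖ * B) (fun n => ?_) ?_
    · exact (norm_inner_le_norm _ _).trans (mul_le_mul_of_nonneg_left (hB n) (norm_nonneg _))
    · simpa using hyp.norm.mul_const B
  have h2 : Tendsto (fun n => inner ℝ (v n - p n) (x - p n)) atTop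
      (𝓝 (inner ℝ (x - y) x + 0 - inner ℝ y (x - y))) := by
    refine (((hvx.tendsto_inner (x - y)).add h1).sub (hy.inner (hy.const_sub x))).congr fun n => ?_
    rw [← inner_add_left, sub_add_sub_cancel, inner_sub_left (v n), real_inner_comm]
  have h3 := le_of_tendsto' h2 fun n => inner_sub_proj_le_zero hS hc hclosed (v n) hx
  have h4 : inner ℝ (x - y) x + 0 - inner ℝ y (x - y) = ‖x - y‖ ^ 2 := by
    rw [add_zero, real_inner_comm, ← inner_sub_left, real_inner_self_eq_norm_sq]
  rw [h4] at h3
  have h5 : x = y := sub_eq_zero.1 (norm_eq_zero.1 (pow_eq_zero_iff two_ne_zero |>.1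
    (le_antisymm h3 (sq_nonneg _))))
  rw [h5]
  exact hy

end Fejer

/-! ### Composite convex minimization -/

lemma cost_le_coe_iff {X : Type*} {G : X → ℝ} {R : X → EReal} {x : X} {r : ℝ} :
    cost G R x ≤ (r : EReal) ↔ R x ≤ ((r - G x : ℝ) : EReal) := by
  unfold cost
  induction R x with
  | bot => simp
  | top => simp [-EReal.coe_sub]
  | coe a =>
    norm_cast
    constructor <;> intro h <;> linarith

lemma exists_coe_eq_of_le_coe {X : Type*} {R : X → EReal} {x : X} (hbot : ∀ z, R z ≠ ⊥) {b : ℝ}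
    (h : R x ≤ (b : EReal)) :
    ∃ a : ℝ, R x = a ∧ a ≤ b := by
  have htop : R x ≠ ⊤ := fun h' => by simp [h'] at h
  lift R x to ℝ using ⟨htop, hbot x⟩ with a
  exact ⟨a, rfl, by exact_mod_cast h⟩

lemma isClosed_setOf_cost_le {X : Type*} [TopologicalSpace X] {G : X → ℝ} {R : X → EReal}
    (hG : Continuous G) (hR : LowerSemicontinuous R) (r : ℝ) :
    IsClosed {z | cost G R z ≤ (r : EReal)} := by
  simp only [cost_le_coe_iff]
  exact hR.isClosed_epigraph.preimage
    (continuous_id.prodMk (continuous_coe_real_ereal.comp (continuous_const.sub hG)))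

section Composite

variable {H : Type*} [NormedAddCommGroup H] [InnerProductSpace ℝ H]
  {G : H → ℝ} {R : H → EReal} {x y : H}

lemma IsConvex.le_combo (hR : IsConvex R) {a b t : ℝ} (hx : R x ≤ (a : EReal))
    (hy : R y ≤ (b : EReal)) (h0 : 0 ≤ t) (h1 : t ≤ 1) :
    R (x + t • (y - x)) ≤ (((1 - t) * a + t * b : ℝ) : EReal) := by
  have h : (1 - t) • (x, a) + t • (y, b) ∈ {p : H × ℝ | R p.1 ≤ (p.2 : EReal)} :=
    hR (x := (x, a)) hx (y := (y, b)) hy (sub_nonneg.2 h1) h0 (by ring)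
  have h3 : x + t • (y - x) = (1 - t) • x + t • y := by module
  rw [h3]
  simpa using h

lemma convex_setOf_cost_le (hG : ConvexOn ℝ univ G) (hR : IsConvex R) (r : ℝ) :
    Convex ℝ {z | cost G R z ≤ (r : EReal)} := by
  intro x hx y hy s t hs ht hst
  simp only [mem_ofPred, cost_le_coe_iff] at hx hy ⊢
  obtain rfl : s = 1 - t := by linarith
  have h1 := hR.le_combo hx hy ht (by linarith)
  rw [show x + t • (y - x) = (1 - t) • x + t • y by module] at h1
  refine h1.trans (EReal.coe_le_coe_iff.2 ?_)
  have h2 := hG.2 (mem_univ x) (mem_univ y) hs ht hst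
  simp only [smul_eq_mul] at h2
  linarith

/-- The direct method: sublevel sets are weakly closed, and a bounded one is weakly compact. -/
lemma exists_forall_cost_le [CompleteSpace H] (hbot : ∀ z, R z ≠ ⊥) (hG : ConvexOn ℝ univ G)
    (hGc : Continuous G) (hR : IsConvex R) (hRl : LowerSemicontinuous R) {r : ℝ}
    (hne : {z | cost G R z ≤ (r : EReal)}.Nonempty)
    (hb : Bornology.IsBounded {z | cost G R z ≤ (r : EReal)}) :
    ∃ z, ∀ w, cost G R z ≤ cost G R w := by
  have hK := isCompact_image_toWeakSpace (convex_setOf_cost_le hG hR r)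
    (isClosed_setOf_cost_le hGc hRl r) hb
  have hl : LowerSemicontinuous fun z => cost G R ((toWeakSpace ℝ H).symm z) := by
    refine lowerSemicontinuous_iff_isClosed_preimage.2 fun y => ?_
    induction y with
    | bot =>
      convert isClosed_empty
      ext z
      simp [cost, EReal.add_eq_bot_iff, hbot]
    | top => simp
    | coe y =>
      convert isClosed_image_toWeakSpace (convex_setOf_cost_le hG hR y)
        (isClosed_setOf_cost_le hGc hRl y)
      exact ((toWeakSpace ℝ H).toEquiv.image_eq_preimage_symm
        {z | cost G R z ≤ (y : EReal)}).symm
  obtain ⟨_, ⟨z, hz, rfl⟩, hmin⟩ := (hl.lowerSemicontinuousOn _).exists_isMinOn (hne.image _) hK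
  refine ⟨z, fun w => ?_⟩
  by_cases hw : cost G R w ≤ (r : EReal)
  · simpa using hmin (mem_image_of_mem (toWeakSpace ℝ H) hw)
  · exact hz.trans (not_le.1 hw).le

/-- First-order optimality: a minimizer of `G + R` satisfies `-∇G x ∈ ∂R x`. -/
lemma sub_inner_le_of_forall_cost_le [CompleteSpace H] {g : H} {a b : ℝ} (hR : IsConvex R)
    (hG : HasGradientAt G g x) (hmin : ∀ w, cost G R x ≤ cost G R w) (hx : R x = (a : EReal))
    (hy : R y ≤ (b : EReal)) : a - inner ℝ g (y - x) ≤ b := by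
  have := le_inner_of_forall_sub_le (y := y - x) (c := b - a) hG fun t h0 h1 => by
    have h2 := hR.le_combo hx.le hy h0.le h1.le
    have h3 : cost G R (x + t • (y - x)) ≤
        ((G (x + t • (y - x)) + ((1 - t) * a + t * b) : ℝ) : EReal) := by
      rw [cost_le_coe_iff]
      simpa using h2
    have h4 := (hmin _).trans h3
    rw [cost, hx, ← EReal.coe_add, EReal.coe_le_coe_iff] at h4
    linarith
  linarith

/-! ### The proximal operator -/

lemma convexOn_quad {α : ℝ} (hα : 0 ≤ α) (u : H) :
    ConvexOn ℝ univ fun v : H => α / 2 * ‖v - u‖ ^ 2 := by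
  have := ((convexOn_univ_dist u).pow (fun _ _ => dist_nonneg) 2).smul
    (show (0 : ℝ) ≤ α / 2 by positivity)
  simpa [dist_eq_norm] using this

lemma hasGradientAt_quad [CompleteSpace H] (α : ℝ) (u v : H) :
    HasGradientAt (fun v : H => α / 2 * ‖v - u‖ ^ 2) (α • (v - u)) v := by
  rw [hasGradientAt_iff_hasFDerivAt]
  have h1 := (((hasFDerivAt_id v).sub_const u).norm_sq).const_mul (α / 2)
  refine h1.congr_fderiv ?_
  ext w
  simp
  ring

lemma isBounded_setOf_cost_quad_le {s w : H} (hw : w ∈ subdiff R s) (hbot : ∀ z, R z ≠ ⊥)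
    {α : ℝ} (hα : 0 < α) (u : H) (r : ℝ) :
    Bornology.IsBounded {z | cost (fun v => α / 2 * ‖v - u‖ ^ 2) R z ≤ (r : EReal)} := by
  obtain ⟨hs, hsub⟩ := hw
  obtain ⟨a, ha⟩ : ∃ a : ℝ, R s = a := by
    lift R s to ℝ using ⟨hs.ne, hbot s⟩ with a
    exact ⟨a, rfl⟩
  set C := |r - a| + ‖w‖ * ‖s - u‖ with hC
  refine (Metric.isBounded_closedBall (x := u) (r := 1 + 2 / α * (‖w‖ + C))).subset fun z hz => ?_
  simp only [mem_ofPred, cost_le_coe_iff] at hz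
  have h1 := (hsub z).trans hz
  rw [ha, ← EReal.coe_add, EReal.coe_le_coe_iff] at h1
  have h2 : -(‖w‖ * ‖z - s‖) ≤ inner ℝ w (z - s) := neg_le_of_abs_le (abs_real_inner_le_norm _ _)
  have h3 : ‖z - s‖ ≤ ‖z - u‖ + ‖s - u‖ := by
    have := norm_sub_le (z - u) (s - u)
    rwa [sub_sub_sub_cancel_right] at this
  have h4 := mul_le_mul_of_nonneg_left h3 (norm_nonneg w)
  have h5 : α / 2 * ‖z - u‖ ^ 2 ≤ ‖w‖ * ‖z - u‖ + C := by
    have := le_abs_self (r - a)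
    rw [hC]
    linarith
  have hC0 : 0 ≤ C := by positivity
  rw [Metric.mem_closedBall, dist_eq_norm]
  by_contra! h6
  have h7 : 1 ≤ ‖z - u‖ := by
    have : 0 ≤ 2 / α * (‖w‖ + C) := by positivity
    linarith
  have h8 : ‖w‖ + C < α / 2 * ‖z - u‖ := by
    have : 2 / α * (‖w‖ + C) < ‖z - u‖ := by linarith
    calc ‖w‖ + C = α / 2 * (2 / α * (‖w‖ + C)) := by field_simp
      _ < α / 2 * ‖z - u‖ := by gcongr
  nlinarith [norm_nonneg w]

/-- The variational inequality of the proximal point `p = prox_{R/α} u`: `α (u - p) ∈ ∂R p`. A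
subgradient of `R` at some point supplies the affine minorant that makes the proximal problem
coercive. -/
lemma prox_spec [CompleteSpace H] (hbot : ∀ z, R z ≠ ⊥) (hR : IsConvex R)
    (hRl : LowerSemicontinuous R) {s w : H} (hw : w ∈ subdiff R s) {α : ℝ} (hα : 0 < α) (u : H) :
    ∃ a : ℝ, R (prox R α u) = a ∧ ∀ v : H, ∀ b : ℝ, R v ≤ (b : EReal) →
      a + α * inner ℝ (u - prox R α u) (v - prox R α u) ≤ b := by
  set Q : H → ℝ := fun v => α / 2 * ‖v - u‖ ^ 2 with hQ
  have hQc : Continuous Q := by fun_prop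
  obtain ⟨c, hc⟩ : ∃ c : ℝ, R s = c := by
    have h1 : R s < ⊤ := hw.1
    lift R s to ℝ using ⟨h1.ne, hbot s⟩ with c
    exact ⟨c, rfl⟩
  have hsQ : cost Q R s ≤ ((Q s + c : ℝ) : EReal) := by rw [cost, hc, EReal.coe_add]
  have hmin : ∀ v, cost Q R (prox R α u) ≤ cost Q R v := by
    have hex := exists_forall_cost_le hbot (convexOn_quad hα.le u) hQc hR hRl ⟨s, hsQ⟩
      (isBounded_setOf_cost_quad_le hw hbot hα u _)
    have := Classical.epsilon_spec (p := fun v => ∀ w,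
      R v + ((α / 2 * ‖v - u‖ ^ 2 : ℝ) : EReal) ≤ R w + ((α / 2 * ‖w - u‖ ^ 2 : ℝ) : EReal)) <| by
        simpa only [cost, hQ, add_comm] using hex
    intro v
    rw [cost, cost, add_comm, add_comm _ (R v)]
    exact this v
  obtain ⟨a, ha, -⟩ := exists_coe_eq_of_le_coe hbot (cost_le_coe_iff.1 ((hmin s).trans hsQ))
  refine ⟨a, ha, fun v b hv => ?_⟩
  have h1 := sub_inner_le_of_forall_cost_le hR (hasGradientAt_quad α u _) hmin ha hv
  rw [real_inner_smul_left, ← neg_sub u, inner_neg_left] at h1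
  linarith

end Composite

/-! ### Critical points -/

section Critical

variable {H : Type*} [NormedAddCommGroup H] [InnerProductSpace ℝ H] [CompleteSpace H]
  {F : H → ℝ} {R : H → EReal} {D : Set H} {L : NNReal}

lemma ConvexSetting.exists_coe_eq (h : ConvexSetting F R D L) {x : H} (hx : x ∈ dom R) :
    ∃ a : ℝ, R x = a := by
  have h1 : R x ≠ ⊤ := hx.ne
  have h2 := h.proper.1 x
  lift R x to ℝ using ⟨h1, h2⟩ with a
  exact ⟨a, rfl⟩

lemma ConvexSetting.hasGradientAt (h : ConvexSetting F R D L) {x : H} (hx : x ∈ D) :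
    HasGradientAt F (gradient F x) x :=
  (h.differentiableAt x hx).hasGradientAt

lemma ConvexSetting.add_inner_le (h : ConvexSetting F R D L) {x : H} (hx : x ∈ D) (v : H) :
    F x + inner ℝ (gradient F x) (v - x) ≤ F v :=
  add_inner_le_of_convexOn h.convex_F (h.hasGradientAt hx) v

lemma ConvexSetting.continuous (h : ConvexSetting F R D L) : Continuous F := by
  obtain ⟨x, hx⟩ := h.proper.2
  exact continuous_of_convexOn_of_continuousAt h.convex_F
    (h.differentiableAt x (h.dom_subset hx)).continuousAt

lemma ConvexSetting.mem_crit_iff (h : ConvexSetting F R D L) {x : H} :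
    x ∈ crit F R ↔ ∀ v, cost F R x ≤ cost F R v := by
  constructor
  · rintro ⟨hx, hsub⟩ v
    obtain ⟨a, ha⟩ := h.exists_coe_eq hx
    by_cases hv : R v = ⊤
    · simp [cost, hv]
    obtain ⟨b, hb⟩ := h.exists_coe_eq (lt_top_iff_ne_top.2 hv)
    have h1 := hsub v
    have h2 := h.add_inner_le (h.dom_subset hx) v
    rw [ha, hb, inner_neg_left] at h1
    rw [cost, cost, ha, hb]
    norm_cast at h1 ⊢
    linarith
  · intro hmin
    obtain ⟨y, hy⟩ := h.proper.2
    obtain ⟨c, hc⟩ := h.exists_coe_eq hy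
    have h1 : cost F R x ≤ ((F y + c : ℝ) : EReal) := (hmin y).trans (by rw [cost, hc]; norm_cast)
    obtain ⟨a, ha, -⟩ := exists_coe_eq_of_le_coe h.proper.1 (cost_le_coe_iff.1 h1)
    have hx : x ∈ dom R := by simp [dom, ha]
    refine ⟨hx, fun v => ?_⟩
    by_cases hv : R v = ⊤
    · simp [hv]
    obtain ⟨b, hb⟩ := h.exists_coe_eq (lt_top_iff_ne_top.2 hv)
    have h2 := sub_inner_le_of_forall_cost_le h.convex_R (h.hasGradientAt (h.dom_subset hx)) hmin
      ha hb.le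
    rw [ha, hb, inner_neg_left]
    exact_mod_cast h2

end Critical

/-! ### One step of the algorithm -/

section Step

variable {H : Type*} [NormedAddCommGroup H] [InnerProductSpace ℝ H] [CompleteSpace H]
  {F : H → ℝ} {R : H → EReal} {D : Set H} {L : NNReal}

/-- For convex `F` the quadratic upper bound holds with `L` in place of `L / 2`, and without
integrating `∇F` along the segment, which need not lie in `D`. -/
lemma ConvexSetting.le_add_inner_add_sq (h : ConvexSetting F R D L) {x y : H} (hx : x ∈ D)
    (hy : y ∈ D) : F y ≤ F x + inner ℝ (gradient F x) (y - x) + L * ‖x - y‖ ^ 2 := by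
  have h1 := h.add_inner_le hy x
  have h2 : inner ℝ (gradient F y - gradient F x) (y - x) ≤ L * ‖x - y‖ ^ 2 := by
    refine (real_inner_le_norm _ _).trans ?_
    have h3 := h.lipschitz.norm_sub_le hy hx
    have h4 := mul_le_mul_of_nonneg_right h3 (norm_nonneg (y - x))
    rw [norm_sub_rev x y]
    linarith
  rw [inner_sub_left] at h2
  rw [← neg_sub, inner_neg_right] at h1
  linarith

/-- The basic prox-grad inequality, comparing the value at `T x` with any other value. -/
lemma ConvexSetting.exists_cost_proxGrad_eq (h : ConvexSetting F R D L)
    (hcrit : (crit F R).Nonempty) {α : ℝ} (hα : 0 < α) {x : H} (hx : x ∈ D) :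
    ∃ r : ℝ, cost F R (proxGrad F R α x) = r ∧ ∀ s : H, ∀ b : ℝ, cost F R s ≤ (b : EReal) →
      r + α * inner ℝ (x - proxGrad F R α x) (s - proxGrad F R α x)
        ≤ b + L * ‖x - proxGrad F R α x‖ ^ 2 := by
  obtain ⟨z, hz⟩ := hcrit
  obtain ⟨a, ha, hprox⟩ := prox_spec h.proper.1 h.convex_R h.lsc hz hα
    (x - (1 / α) • gradient F x)
  change R (proxGrad F R α x) = a at ha
  change ∀ v : H, ∀ b : ℝ, R v ≤ (b : EReal) → a + α * inner ℝ (x - (1 / α) • gradient F x -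
    proxGrad F R α x) (v - proxGrad F R α x) ≤ b at hprox
  set T := proxGrad F R α x
  have hT : T ∈ D := h.dom_subset (by simp [dom, ha])
  refine ⟨F T + a, by rw [cost, ha, EReal.coe_add], fun s b hs => ?_⟩
  have h1 := hprox s _ (cost_le_coe_iff.1 hs)
  have h2 := h.add_inner_le hx s
  have h3 := h.le_add_inner_add_sq hx hT
  have h4 : α * inner ℝ (x - (1 / α) • gradient F x - T) (s - T) =
      α * inner ℝ (x - T) (s - T) - inner ℝ (gradient F x) (s - T) := by
    rw [sub_right_comm, inner_sub_left, real_inner_smul_left]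
    field_simp
  have h5 : inner ℝ (gradient F x) (s - x) =
      inner ℝ (gradient F x) (s - T) + inner ℝ (gradient F x) (T - x) := by
    rw [← inner_add_right, sub_add_sub_cancel]
  linarith

lemma sub_smul_gradMap {α : ℝ} (hα : 0 < α) (x : H) :
    x - (1 / α) • gradMap F R α x = proxGrad F R α x := by
  rw [gradMap, smul_smul, one_div_mul_cancel hα.ne', one_smul, sub_sub_cancel]

lemma div_mul_norm_gradMap_sq {α : ℝ} (hα : 0 < α) (δ : ℝ) (x : H) :
    δ / α * ‖gradMap F R α x‖ ^ 2 = δ * α * ‖x - proxGrad F R α x‖ ^ 2 := by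
  rw [gradMap, norm_smul, Real.norm_of_nonneg hα.le, mul_pow]
  field_simp

/-- The linesearch accepts every large `α`: the window contains the current cost. -/
lemma ConvexSetting.lineSearch_of_le (h : ConvexSetting F R D L) (hcrit : (crit F R).Nonempty)
    {δ α : ℝ} (hα : 0 < α) (hαL : L ≤ (1 - δ) * α) (mmax : ℕ) (u : ℕ → H) (k : ℕ) {b : ℝ}
    (hk : u k ∈ D) (hb : cost F R (u k) = b) : LineSearch F R δ mmax u k α := by
  obtain ⟨r, hr, hle⟩ := h.exists_cost_proxGrad_eq hcrit hα hk
  have h1 := hle (u k) b hb.le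
  rw [real_inner_self_eq_norm_sq] at h1
  have h2 : (b : EReal) ≤ windowMax F R mmax u k := by
    have := Finset.le_sup (f := fun j => cost F R (u (k - j)))
      (Finset.mem_range.2 (Nat.succ_pos (memory mmax k)))
    simpa [windowMax, hb] using this
  rw [LineSearch, hr, div_mul_norm_gradMap_sq hα]
  refine le_trans ?_ (EReal.sub_le_sub h2 le_rfl)
  rw [← EReal.coe_sub, EReal.coe_le_coe_iff]
  nlinarith [sq_nonneg ‖u k - proxGrad F R α (u k)‖]

lemma memory_eq_min (mmax k : ℕ) : memory mmax k = min k mmax := by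
  induction k with
  | zero => simp [memory]
  | succ k ih => rw [memory, ih]; omega

end Step

/-! ### The nonmonotone algorithm -/

lemma optVal_eq_cost_of_forall_le {X : Type*} {F : X → ℝ} {R : X → EReal} {z : X}
    (hz : ∀ v, cost F R z ≤ cost F R v) :
    optVal F R = cost F R z :=
  le_antisymm (iInf_le _ z) (le_iInf hz)

section Algorithm

variable {H : Type*} [NormedAddCommGroup H] [InnerProductSpace ℝ H] [CompleteSpace H]
  {F : H → ℝ} {R : H → EReal} {D : Set H} {L : NNReal}

lemma ConvexSetting.exists_optVal_eq (h : ConvexSetting F R D L) (hcrit : (crit F R).Nonempty) :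
    ∃ c : ℝ, optVal F R = c := by
  obtain ⟨z, hz⟩ := hcrit
  obtain ⟨a, ha⟩ := h.exists_coe_eq hz.1
  refine ⟨F z + a, ?_⟩
  rw [optVal_eq_cost_of_forall_le (h.mem_crit_iff.1 hz), cost, ha, EReal.coe_add]

lemma ConvexSetting.crit_eq_setOf (h : ConvexSetting F R D L) {c : ℝ}
    (hc : optVal F R = c) : crit F R = {z | cost F R z ≤ (c : EReal)} := by
  ext z
  rw [h.mem_crit_iff, mem_ofPred, ← hc]
  exact ⟨fun hz => (optVal_eq_cost_of_forall_le hz).ge, fun hz v => hz.trans (iInf_le _ v)⟩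

/-- The trial step sizes rise only until `L ≤ (1 - δ) α`, so the accepted ones are bounded. -/
lemma ConvexSetting.stepSize_le (h : ConvexSetting F R D L) (hcrit : (crit F R).Nonempty)
    {δ η αinf αsup β : ℝ} (hδ₁ : δ < 1) (hη : 1 < η) (hαinf : 0 < αinf) (hαsup : αinf < αsup)
    {mmax : ℕ} {u : ℕ → H} {k i : ℕ} {b : ℝ} (hk : u k ∈ D) (hb : cost F R (u k) = b)
    (hi : IsLeast {n : ℕ | LineSearch F R δ mmax u k (max αinf (min αsup β) * η ^ n)} i) :
    max αinf (min αsup β) * η ^ i ≤ αsup + η * (L / (1 - δ)) := by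
  have hη0 : 0 < η := zero_lt_one.trans hη
  have hδ : 0 < 1 - δ := sub_pos.2 hδ₁
  have hL : 0 ≤ η * (L / (1 - δ)) := by positivity
  cases i with
  | zero =>
    have : max αinf (min αsup β) ≤ αsup := max_le hαsup.le (min_le_left _ _)
    rw [pow_zero]
    linarith
  | succ j =>
    have hpos : 0 < max αinf (min αsup β) * η ^ j := by positivity
    have h1 : ¬ LineSearch F R δ mmax u k (max αinf (min αsup β) * η ^ j) := fun hj =>
      absurd (hi.2 hj) (by omega)
    have h2 : (1 - δ) * (max αinf (min αsup β) * η ^ j) < L := by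
      by_contra! h3
      exact h1 (h.lineSearch_of_le hcrit hpos h3 mmax u k hk hb)
    have h3 : max αinf (min αsup β) * η ^ j ≤ L / (1 - δ) := by
      rw [le_div_iff₀ hδ]
      linarith
    have h4 := mul_le_mul_of_nonneg_left h3 hη0.le
    rw [pow_succ]
    linarith

/-- The real sequences governing a run. From the first step on the costs are finite; the excess
costs `a` never exceed their sliding maximum and are summable, and the iterates form a
quasi-Fejér sequence with respect to the critical points. -/
theorem ConvexSetting.exists_excess_quasiFejer (h : ConvexSetting F R D L)
    (hcrit : (crit F R).Nonempty) {δ η αinf αsup : ℝ} (hδ₀ : 0 < δ) (hδ₁ : δ < 1) (hη : 1 < η)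
    (hαinf : 0 < αinf) (hαsup : αinf < αsup) {mmax : ℕ} {u : ℕ → H} (hu₀ : u 0 ∈ D)
    (hu : IsGenerated F R δ η mmax αinf αsup u) {c : ℝ} (hc : optVal F R = c) :
    ∃ a ε : ℕ → ℝ, (∀ n, cost F R (u (n + 1)) = ((c + a n : ℝ) : EReal)) ∧ (∀ n, 0 ≤ a n) ∧
      (∀ n, a (n + mmax + 1) ≤ slidingMax a mmax n) ∧ Summable a ∧ (∀ n, 0 ≤ ε n) ∧ Summable ε ∧
      ∀ s ∈ crit F R, ∀ n, ‖u (n + 2) - s‖ ^ 2 ≤ ‖u (n + 1) - s‖ ^ 2 + ε n := by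
  obtain ⟨β, α, i, hgen⟩ := hu
  have hαlow : ∀ k, αinf ≤ α k := fun k => by
    rw [(hgen k).2.1]
    calc αinf ≤ max αinf (min αsup (β k)) := le_max_left _ _
      _ ≤ max αinf (min αsup (β k)) * η ^ i k :=
        le_mul_of_one_le_right (hαinf.le.trans (le_max_left _ _)) (one_le_pow₀ hη.le)
  have hαpos : ∀ k, 0 < α k := fun k => hαinf.trans_le (hαlow k)
  have hnext : ∀ k, u (k + 1) = proxGrad F R (α k) (u k) := fun k => by
    rw [(hgen k).2.2, sub_smul_gradMap (hαpos k)]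
  have hstep : ∀ k, u k ∈ D → ∃ r : ℝ, cost F R (u (k + 1)) = r ∧
      ∀ s : H, ∀ b : ℝ, cost F R s ≤ (b : EReal) →
        r + α k * inner ℝ (u k - u (k + 1)) (s - u (k + 1)) ≤ b + L * ‖u k - u (k + 1)‖ ^ 2 :=
    fun k hk => by
      rw [hnext k]
      exact h.exists_cost_proxGrad_eq hcrit (hαpos k) hk
  have hdom : ∀ {x : H} {r : ℝ}, cost F R x = r → x ∈ D := fun {x r} hr => by
    obtain ⟨y, hy, -⟩ := exists_coe_eq_of_le_coe h.proper.1 (cost_le_coe_iff.1 hr.le)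
    exact h.dom_subset (by simp [dom, hy])
  have huD : ∀ k, u k ∈ D := fun k => by
    induction k with
    | zero => exact hu₀
    | succ k ih =>
      obtain ⟨r, hr, -⟩ := hstep k ih
      exact hdom hr
  choose r hr hrle using fun k => hstep k (huD k)
  -- `r n` is the cost of `u (n + 1)`; that of `u 0` may be infinite
  set a : ℕ → ℝ := fun n => r n - c with ha
  have hcost : ∀ n, cost F R (u (n + 1)) = ((c + a n : ℝ) : EReal) := fun n => by
    rw [hr n, ha, add_sub_cancel]
  have ha0 : ∀ n, 0 ≤ a n := fun n => by
    have h1 : optVal F R ≤ cost F R (u (n + 1)) := iInf_le _ _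
    rw [hc, hr n, EReal.coe_le_coe_iff] at h1
    exact sub_nonneg.2 h1
  set e : ℕ → ℝ := fun n => ‖u (n + 1) - u (n + 2)‖ ^ 2 with he
  have he0 : ∀ n, 0 ≤ e n := fun n => sq_nonneg _
  -- `L + 1` in place of `L` makes the constant positive also for `L = 0`
  have hup : ∀ n, a (n + 1) ≤ a n + (L + 1) * e n := fun n => by
    have h1 := hrle (n + 1) (u (n + 1)) (r n) (hr n).le
    rw [real_inner_self_eq_norm_sq] at h1
    have h2 := mul_nonneg (hαpos (n + 1)).le (he0 n)
    have h3 := he0 n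
    simp only [ha, he] at h2 h3 ⊢
    linarith
  -- from index `mmax + 1` on the memory is full and the window avoids `u 0`
  have hwin : ∀ n, a (n + mmax + 1) ≤ slidingMax a mmax n - δ * αinf * e (n + mmax) := fun n => by
    have h1 : LineSearch F R δ mmax u (n + mmax + 1) (α (n + mmax + 1)) := by
      rw [(hgen (n + mmax + 1)).2.1]
      exact (hgen (n + mmax + 1)).1.1
    have h2 : windowMax F R mmax u (n + mmax + 1) ≤ ((c + slidingMax a mmax n : ℝ) : EReal) := by
      refine Finset.sup_le fun j hj => ?_
      rw [memory_eq_min, min_eq_right (by omega), Finset.mem_range] at hj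
      have h3 := le_slidingMax (a := a) (n := n) (j := mmax - j) (Nat.sub_le _ _)
      rw [show n + mmax + 1 - j = n + (mmax - j) + 1 by omega, hcost, EReal.coe_le_coe_iff]
      linarith
    rw [LineSearch, div_mul_norm_gradMap_sq (hαpos _), ← hnext, hcost] at h1
    have h4 := h1.trans (EReal.sub_le_sub h2 le_rfl)
    rw [← EReal.coe_sub, EReal.coe_le_coe_iff] at h4
    have h5 := mul_le_mul_of_nonneg_right
      (mul_le_mul_of_nonneg_left (hαlow (n + mmax + 1)) hδ₀.le) (he0 (n + mmax))
    simp only [he] at h5 ⊢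
    linarith
  have hes : Summable e :=
    summable_of_nonmonotone_decrease (mul_pos hδ₀ hαinf) (by positivity) ha0 he0 hup hwin
  have hwin' : ∀ n, a (n + mmax + 1) ≤ slidingMax a mmax n := fun n => by
    have := mul_nonneg (mul_pos hδ₀ hαinf).le (he0 (n + mmax))
    linarith [hwin n]
  set A := αsup + η * (L / (1 - δ))
  have hαA : ∀ n, α (n + 1) ≤ A := fun n => by
    rw [(hgen (n + 1)).2.1]
    exact h.stepSize_le hcrit hδ₁ hη hαinf hαsup (huD _) (hr n) (hgen (n + 1)).1
  have hApos : 0 < A := (hαpos 1).trans_le (hαA 0)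
  set ε : ℕ → ℝ := fun n => 2 * L / αinf * e n with hε
  have hε0 : ∀ n, 0 ≤ ε n := fun n => mul_nonneg (by positivity) (he0 n)
  have hεs : Summable ε := hes.mul_left _
  -- the prox-grad inequality at `s`, with the inner product expanded by the polarization identity
  have hfejer : ∀ s ∈ crit F R, ∀ n,
      ‖u (n + 2) - s‖ ^ 2 + 2 / A * a (n + 1) ≤ ‖u (n + 1) - s‖ ^ 2 + ε n := fun s hs n => by
    have hsc : cost F R s ≤ (c : EReal) := by
      rw [← hc, optVal_eq_cost_of_forall_le (h.mem_crit_iff.1 hs)]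
    have h1 := hrle (n + 1) s c hsc
    have h2 : u (n + 1) - s = (u (n + 1) - u (n + 2)) - (s - u (n + 2)) := by abel
    have h3 : ‖u (n + 1) - s‖ ^ 2 = e n - 2 * inner ℝ (u (n + 1) - u (n + 2)) (s - u (n + 2))
        + ‖u (n + 2) - s‖ ^ 2 := by
      rw [h2, norm_sub_sq_real, norm_sub_rev (u (n + 2)) s]
    set I := inner ℝ (u (n + 1) - u (n + 2)) (s - u (n + 2))
    have h4 : a (n + 1) + α (n + 1) * I ≤ L * e n := by
      simp only [ha, he]
      linarith
    have h5 : 2 / A * a (n + 1) ≤ 2 / α (n + 1) * a (n + 1) :=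
      mul_le_mul_of_nonneg_right
        (div_le_div_of_nonneg_left zero_le_two (hαpos _) (hαA n)) (ha0 _)
    have h6 : 2 / α (n + 1) * (L * e n) ≤ ε n := by
      have h7 : 2 / α (n + 1) ≤ 2 / αinf :=
        div_le_div_of_nonneg_left zero_le_two hαinf (hαlow _)
      have h8 := mul_le_mul_of_nonneg_right h7 (mul_nonneg L.coe_nonneg (he0 n))
      calc _ ≤ _ := h8
        _ = ε n := by simp only [hε]; ring
    have h7 := mul_le_mul_of_nonneg_left h4 (div_pos zero_lt_two (hαpos (n + 1))).le
    have h8 : 2 / α (n + 1) * (a (n + 1) + α (n + 1) * I) = 2 / α (n + 1) * a (n + 1) + 2 * I := by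
      have := (hαpos (n + 1)).ne'
      field_simp
    linarith [he0 n]
  have has : Summable a := by
    obtain ⟨s, hs⟩ := hcrit
    have h1 := summable_of_add_le_add (fun n => sq_nonneg ‖u (n + 1) - s‖)
      (fun n => mul_nonneg (div_pos zero_lt_two hApos).le (ha0 (n + 1))) hε0 hεs (hfejer s hs)
    exact (summable_nat_add_iff 1).1
      ((summable_mul_left_iff (div_pos zero_lt_two hApos).ne').1 h1)
  refine ⟨a, ε, hcost, ha0, hwin', has, hε0, hεs, fun s hs n => ?_⟩
  have := mul_nonneg (div_pos zero_lt_two hApos).le (ha0 (n + 1))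
  linarith [hfejer s hs n]

end Algorithm

end FBS

theorem mainTheorem2 {H : Type*} [NormedAddCommGroup H] [InnerProductSpace ℝ H] [CompleteSpace H]
    (F : H → ℝ) (R : H → EReal) (D : Set H) (L : NNReal)
    (hFR : FBS.ConvexSetting F R D L)
    (hcrit : (FBS.crit F R).Nonempty)
    (δ η : ℝ) (hδ₀ : 0 < δ) (hδ₁ : δ < 1) (hη : 1 < η)
    (mmax : ℕ) (αinf αsup : ℝ) (hαinf : 0 < αinf) (hαsup : αinf < αsup)
    (u : ℕ → H) (hu₀ : u 0 ∈ D)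
    (hu : FBS.IsGenerated F R δ η mmax αinf αsup u) :
    (∀ x, FBS.IsWeakSeqAccPt u x → x ∈ FBS.crit F R) ∧
    (∃ ustar ∈ FBS.crit F R,
      (∀ v, FBS.cost F R ustar ≤ FBS.cost F R v) ∧
      FBS.WeakTendsto u ustar ∧
      Filter.Tendsto (fun k => FBS.proj (FBS.crit F R) (u k)) Filter.atTop (nhds ustar)) ∧
    Filter.Tendsto (fun k => FBS.cost F R (u k)) Filter.atTop (nhds (FBS.optVal F R)) ∧
    (∃ ρ₁ > (0 : ℝ), ∃ ρ₂ > (0 : ℝ), ∃ K : ℕ, ∀ k ≥ K,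
      FBS.cost F R (u k) - FBS.optVal F R ≤ ((ρ₁ / (ρ₂ + k) : ℝ) : EReal)) := by
  obtain ⟨c, hc⟩ := hFR.exists_optVal_eq hcrit
  obtain ⟨a, ε, hcost, ha0, hwin, has, hε0, hεs, hfejer⟩ :=
    hFR.exists_excess_quasiFejer hcrit hδ₀ hδ₁ hη hαinf hαsup hu₀ hu hc
  have hcritc := hFR.crit_eq_setOf hc
  have hconv : Convex ℝ (FBS.crit F R) := by
    rw [hcritc]
    exact FBS.convex_setOf_cost_le hFR.convex_F hFR.convex_R c
  have hclosed : IsClosed (FBS.crit F R) := by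
    rw [hcritc]
    exact FBS.isClosed_setOf_cost_le hFR.continuous hFR.lsc c
  have ha : Filter.Tendsto a Filter.atTop (nhds 0) := has.tendsto_atTop_zero
  have hclus : ∀ x, MapClusterPt (toWeakSpace ℝ H x) Filter.atTop
      (fun n => toWeakSpace ℝ H (u (n + 1))) → x ∈ FBS.crit F R := by
    intro x hx
    have hle : ∀ r : ℝ, c < r → FBS.cost F R x ≤ (r : EReal) := fun r hr => by
      refine FBS.mem_of_mapClusterPt_toWeakSpace
        (FBS.convex_setOf_cost_le hFR.convex_F hFR.convex_R r)
        (FBS.isClosed_setOf_cost_le hFR.continuous hFR.lsc r) (v := fun n => u (n + 1)) ?_ hx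
      filter_upwards [ha.eventually_lt_const (sub_pos.2 hr)] with n hn
      rw [hcost, EReal.coe_le_coe_iff]
      linarith
    rw [hcritc, Set.mem_ofPred]
    refine EReal.le_of_forall_lt_iff_le.1 fun r hr => hle r (by exact_mod_cast hr)
  obtain ⟨x, hx, hlim⟩ := FBS.exists_weakTendsto_of_quasiFejer (v := fun n => u (n + 1)) hcrit
    hε0 hεs hfejer hclus
  have hproj := FBS.tendsto_proj_of_quasiFejer (v := fun n => u (n + 1)) hcrit hconv hclosed
    hε0 hεs hfejer hx hlim
  have hux : FBS.WeakTendsto u x :=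
    (Filter.tendsto_add_atTop_iff_nat (f := fun k => toWeakSpace ℝ H (u k)) 1).1 hlim
  refine ⟨?_, ⟨x, hx, hFR.mem_crit_iff.1 hx, hux, ?_⟩, ?_, ?_⟩
  -- the whole sequence converges weakly, so `x` is its only weak accumulation point
  · rintro y ⟨φ, hφ, hy⟩
    have hxφ : FBS.WeakTendsto (u ∘ φ) x := hux.comp hφ.tendsto_atTop
    rwa [FBS.weakTendsto_unique hy hxφ]
  · exact (Filter.tendsto_add_atTop_iff_nat
      (f := fun k => FBS.proj (FBS.crit F R) (u k)) 1).1 hproj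
  · refine (Filter.tendsto_add_atTop_iff_nat (f := fun k => FBS.cost F R (u k)) 1).1 ?_
    simp only [hcost, hc]
    refine (continuous_coe_real_ereal.tendsto c).comp ?_
    simpa using ha.const_add c
  · obtain ⟨B, hB, hle⟩ := FBS.exists_le_div_of_summable hwin ha0 has
    -- the bound `B / k` for `u k` is at most `2 B / (1 + k)`
    refine ⟨2 * B, by positivity, 1, one_pos, 1, fun k hk => ?_⟩
    obtain ⟨n, rfl⟩ := Nat.exists_eq_add_of_le' hk
    rw [hcost, hc, ← EReal.coe_sub, EReal.coe_le_coe_iff, add_sub_cancel_left]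
    refine (hle n).trans ?_
    rw [div_le_div_iff₀ (by positivity) (by positivity)]
    push_cast
    nlinarith [mul_nonneg hB.le (Nat.cast_nonneg (α := ℝ) n)]
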